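/- Let $\mathbb{F}_q$ be a finite field with $q$ elements and $M(n,q)$ the set of all $n\times n$ matrices over $\mathbb{F}_q$. For $X\in M(n,q)$ regard the space of row vectors $V=\mathbb{F}_q^{1\times n}$ as an $\mathbb{F}_q[t]$-module with $t$ acting as $v\mapsto vX$, and for a monic irreducible polynomial $g\in\mathbb{F}_q[t]$ let $V(g)=\{v\in V : v\,g(X)^k=0 \text{ for some } k\ge 0\}$ be its $g$-primary component. The matrix $X$ is called $f$-cyclic if there is a monic irreducible divisor $g$ of the characteristic polynomial of $X$ such that $V(g)$ is a cyclic $\mathbb{F}_q[t]$-module, that is, generated by a single vector. Theorem. There is a constant $c$ with $0<c<1$ such that, for all finite field sizes $q$ and all dimensions $n\ge 1$, the proportion of $f$-cyclic matrices in $M(n,q)$ is at least $1-c^n$: $$\frac{|\{X\in M(n,q) : X \text{ is } f\text{-cyclic}\}|}{q^{n^2}}\ \ge\ 1-c^n .$$ Moreover, the constant $c=0.983$ has this property for all $q$ and all $n\ge 1$. -/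

import Mathlib

open Polynomial

/-- The space `F^{1×n}` of row vectors, as an `F[t]`-module on which `t` acts by `v ↦ v X`. -/
abbrev RowModule {F : Type*} [Field F] {n : ℕ} (X : Matrix (Fin n) (Fin n) F) : Type _ :=
  Module.AEval' X.vecMulLinear

/-- The `g`-primary component of the row space of `X`: all row vectors that are killed by some
power of `g(X)`. -/
noncomputable def primaryPart {F : Type*} [Field F] {n : ℕ} (X : Matrix (Fin n) (Fin n) F) (g : F[X]) :
    Submodule F[X] (RowModule X) :=
  Ideal.primaryComponent (RowModule X) (Ideal.span {g})

/-- `X` is `f`-cyclic relative to `g` if its `g`-primary component is generated, as an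
`F[t]`-module, by a single vector. -/
def IsFCyclicRel {F : Type*} [Field F] {n : ℕ} (X : Matrix (Fin n) (Fin n) F) (g : F[X]) : Prop :=
  ∃ v : RowModule X, primaryPart X g = Submodule.span F[X] {v}

/-- `X` is `f`-cyclic if it is `f`-cyclic relative to some monic irreducible divisor of its
characteristic polynomial. -/
def IsFCyclic {F : Type*} [Field F] {n : ℕ} (X : Matrix (Fin n) (Fin n) F) : Prop :=
  ∃ g : F[X], g.Monic ∧ Irreducible g ∧ g ∣ X.charpoly ∧ IsFCyclicRel X g

/-- The proportion of `f`-cyclic matrices among all `n × n` matrices over the finite field `F`. -/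
noncomputable def fCyclicProportion (F : Type*) [Field F] [Finite F] (n : ℕ) : ℝ :=
  (Nat.card {X : Matrix (Fin n) (Fin n) F // IsFCyclic X} : ℝ) /
    (Nat.card (Matrix (Fin n) (Fin n) F) : ℝ)

/-! Fix a nonzero vector `v` and sort the matrices by the dimension `k` of the cyclic submodule `W`
that `v` generates. Let `f` be the annihilator of `v`, of degree `k`, and `c` the characteristic
polynomial induced on V/W, of degree `n - k`. If an irreducible factor `g` of `f` does not divide
`c`, then `c` is invertible on V(g) and maps V into `W`. So V(g) lies in the cyclic module `W` and
is itself cyclic. Hence for a matrix that is not `f`-cyclic every irreducible factor of `f` divides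
`c` (`dvd_charpoly_complementEnd_of_not_isFCyclic`).

The Krylov vectors and the action on a complement of `W` determine `c`; only `f` is then free. It
has at most `q^k` values, and at most `multichoose (n-k) k = choose (n-1) k` by
`card_le_multichoose_of_factors_dvd`. Summing over `k` bounds the exceptional proportion by the sum
of min(q^k, choose (n-1) k) / q^n. This is exponentially small: the first bound wins for `k` well
below `n`, the second for `k` near `n` (`sum_min_choose_le`). -/

/-- The monic polynomial `X ^ k - ∑ aᵢ X ^ i`. -/
noncomputable def monicOfCoeffs {F : Type*} [Field F] {k : ℕ} (a : Fin k → F) : F[X] :=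
  X ^ k - ∑ i : Fin k, C (a i) * X ^ (i : ℕ)

theorem degree_sum_C_mul_X_pow_lt {F : Type*} [Field F] {k : ℕ} (a : Fin k → F) :
    (∑ i : Fin k, C (a i) * X ^ (i : ℕ)).degree < (k : WithBot ℕ) := by
  refine (degree_sum_le _ _).trans_lt ?_
  refine (Finset.sup_lt_iff (WithBot.bot_lt_coe k)).2 fun i _ => ?_
  exact (degree_C_mul_X_pow_le _ _).trans_lt (WithBot.coe_lt_coe.2 i.2)

theorem monicOfCoeffs_monic {F : Type*} [Field F] {k : ℕ} (a : Fin k → F) :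
    (monicOfCoeffs a).Monic :=
  monic_X_pow_sub (degree_sum_C_mul_X_pow_lt a)

theorem natDegree_monicOfCoeffs {F : Type*} [Field F] {k : ℕ} (a : Fin k → F) :
    (monicOfCoeffs a).natDegree = k := by
  apply natDegree_eq_of_degree_eq_some
  rw [monicOfCoeffs, degree_sub_eq_left_of_degree_lt] <;> rw [degree_X_pow]
  exact degree_sum_C_mul_X_pow_lt a

theorem monicOfCoeffs_injective {F : Type*} [Field F] {k : ℕ} :
    Function.Injective (monicOfCoeffs : (Fin k → F) → F[X]) := by
  intro a b h
  ext j
  have := congrArg (fun p => p.coeff (j : ℕ)) h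
  simp only [monicOfCoeffs, coeff_sub, finsetSum_coeff, coeff_C_mul, coeff_X_pow, Fin.val_inj,
    mul_ite, mul_one, mul_zero, Finset.sum_ite_eq, Finset.mem_univ, if_true, sub_right_inj] at this
  exact this

/-! ### Cyclic subspaces and the map induced on a complement. -/

section Krylov

variable {F V : Type*} [Field F] [AddCommGroup V] [Module F V]

/-- The vectors `v, T v, …, T ^ (k - 1) v` form a basis of the cyclic subspace generated by `v`. -/
def IsKrylovDegree (T : Module.End F V) (v : V) (k : ℕ) : Prop :=
  LinearIndependent F (fun i : Fin k => (T ^ (i : ℕ)) v) ∧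
    (T ^ k) v ∈ Submodule.span F (Set.range fun i : Fin k => (T ^ (i : ℕ)) v)

theorem exists_isKrylovDegree [FiniteDimensional F V] (T : Module.End F V) {v : V} (hv : v ≠ 0) :
    ∃ k, 1 ≤ k ∧ k ≤ Module.finrank F V ∧ IsKrylovDegree T v k := by
  classical
  let P : ℕ → Prop := fun k => LinearIndependent F (fun i : Fin k => (T ^ (i : ℕ)) v)
  have hle : ∀ k, P k → k ≤ Module.finrank F V := fun k hk => by
    simpa using hk.fintype_card_le_finrank
  have h1 : P 1 := by
    simpa [P] using hv
  set k := Nat.findGreatest P (Module.finrank F V) with hk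
  have hPk : P k := Nat.findGreatest_spec (hle 1 h1) h1
  refine ⟨k, Nat.le_findGreatest (hle 1 h1) h1, hle k hPk, hPk, ?_⟩
  by_contra hmem
  have hs : P (k + 1) := by
    change LinearIndependent F (fun i : Fin (k + 1) => (T ^ (i : ℕ)) v)
    rw [linearIndependent_finSucc']
    exact ⟨hPk, hmem⟩
  have := Nat.le_findGreatest (hle _ hs) hs
  omega

theorem IsKrylovDegree.map_mem_span {T : Module.End F V} {v : V} {k : ℕ}
    (h : IsKrylovDegree T v k) {w : V}
    (hw : w ∈ Submodule.span F (Set.range fun i : Fin k => (T ^ (i : ℕ)) v)) :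
    T w ∈ Submodule.span F (Set.range fun i : Fin k => (T ^ (i : ℕ)) v) := by
  have : Submodule.span F (Set.range fun i : Fin k => (T ^ (i : ℕ)) v) ≤
      (Submodule.span F (Set.range fun i : Fin k => (T ^ (i : ℕ)) v)).comap T := by
    rw [Submodule.span_le]
    rintro _ ⟨i, rfl⟩
    have hs : T ((T ^ (i : ℕ)) v) = (T ^ ((i : ℕ) + 1)) v := by
      rw [pow_succ', Module.End.mul_apply]
    simp only [SetLike.mem_coe, Submodule.mem_comap, hs]
    rcases (Nat.succ_le_of_lt i.2).lt_or_eq with hi | hi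
    · exact Submodule.subset_span ⟨⟨i + 1, hi⟩, rfl⟩
    · rw [← Nat.succ_eq_add_one, hi]
      exact h.2
  exact this hw

/-- The remainder modulo `f` also kills `v`, and independence of the Krylov vectors forces its
coefficients to vanish. -/
theorem IsKrylovDegree.dvd_of_aeval_apply_eq_zero {T : Module.End F V} {v : V} {k : ℕ}
    (h : IsKrylovDegree T v k) {f p : F[X]} (hf : f.Monic) (hfk : f.natDegree = k)
    (hfv : aeval T f v = 0) (hpv : aeval T p v = 0) : f ∣ p := by
  rcases Nat.eq_zero_or_pos k with hk | hk
  · rw [hf.natDegree_eq_zero.1 (hfk.trans hk)]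
    exact one_dvd p
  rw [← modByMonic_eq_zero_iff_dvd hf]
  have hr : aeval T (p %ₘ f) v = 0 := by
    rw [modByMonic_eq_sub_mul_div, mul_comm, map_sub, map_mul]
    simp [hfv, hpv]
  have hdeg : (p %ₘ f).natDegree < k := hfk ▸ natDegree_modByMonic_lt p hf (by
    rintro rfl
    simp at hfk
    omega)
  rw [aeval_eq_sum_range' hdeg, LinearMap.sum_apply, Finset.sum_range] at hr
  have := Fintype.linearIndependent_iff.1 h.1 (fun i => (p %ₘ f).coeff i) (by simpa using hr)
  ext j
  rcases lt_or_ge j k with hj | hj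
  · simpa using this ⟨j, hj⟩
  · rw [coeff_eq_zero_of_natDegree_lt (hdeg.trans_le hj), coeff_zero]

theorem aeval_monicOfCoeffs_apply {T : Module.End F V} {v : V} {k : ℕ} {a : Fin k → F}
    (ha : ∑ i, a i • (T ^ (i : ℕ)) v = (T ^ k) v) : aeval T (monicOfCoeffs a) v = 0 := by
  simp [monicOfCoeffs, ← ha, LinearMap.sum_apply]

/-- The endomorphism of a complement `U` of `W` induced by `R : U → V`. -/
noncomputable def complementEnd {W U : Submodule F V} (hWU : IsCompl U W) (R : U →ₗ[F] V) :
    Module.End F U :=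
  (U.projectionOnto W hWU).comp R

/-- Cayley–Hamilton on V/W, with the complement `U` as a model of the quotient: the projection along
`W` intertwines `T` with the induced map. -/
theorem aeval_charpoly_complementEnd_apply_mem [FiniteDimensional F V] {W U : Submodule F V}
    (hWU : IsCompl U W) (T : Module.End F V) (hW : ∀ w ∈ W, T w ∈ W) (u : V) :
    aeval T (complementEnd hWU (T.comp U.subtype)).charpoly u ∈ W := by
  set Y := complementEnd hWU (T.comp U.subtype) with hY
  set π := U.projectionOnto W hWU with hπ
  have hker : ∀ w, w ∈ W ↔ π w = 0 := fun w => by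
    rw [← LinearMap.mem_ker, hπ, Submodule.ker_projectionOnto]
  have hcomm : ∀ x, π (T x) = Y (π x) := by
    intro x
    have hx : x - (π x : V) ∈ W := by
      rw [hker, map_sub, hπ, Submodule.projectionOnto_apply_left, sub_self]
    have := (hker _).1 (hW _ hx)
    rw [map_sub, map_sub, sub_eq_zero] at this
    exact this
  have hpoly : ∀ (p : F[X]) (x : V), π (aeval T p x) = aeval Y p (π x) := by
    intro p
    induction p using Polynomial.induction_on' with
    | add p q hp hq => intro x; simp [hp, hq]
    | monomial j c =>
      intro x
      have : ∀ (j : ℕ) (x : V), π ((T ^ j) x) = (Y ^ j) (π x) := by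
        intro j
        induction j with
        | zero => intro x; simp
        | succ j ih =>
          intro x
          rw [pow_succ, pow_succ, Module.End.mul_apply, Module.End.mul_apply, ih, hcomm]
      simp [aeval_monomial, this]
  rw [hker, hpoly, LinearMap.aeval_self_charpoly, LinearMap.zero_apply]

end Krylov

/-! ### A criterion for being `f`-cyclic. -/

section FCyclic

variable {F : Type*} [Field F] {n : ℕ}

theorem aeval_vecMulLinear_apply (M : Matrix (Fin n) (Fin n) F) (p : F[X]) (v : Fin n → F) :
    aeval M.vecMulLinear p v = Matrix.vecMul v (aeval M p) := by
  have hpow : ∀ (j : ℕ) (v : Fin n → F), (M.vecMulLinear ^ j) v = Matrix.vecMul v (M ^ j) := by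
    intro j
    induction j with
    | zero => intro v; simp
    | succ j ih =>
      intro v
      rw [pow_succ, Module.End.mul_apply, ih, pow_succ', ← Matrix.vecMul_vecMul]
      rfl
  induction p using Polynomial.induction_on' with
  | add p q hp hq => simp [hp, hq, Matrix.vecMul_add]
  | monomial j c =>
    rw [aeval_monomial, aeval_monomial, Module.End.mul_apply, hpow,
      ← Algebra.smul_def, Matrix.vecMul_smul]
    simp

/-- Since `c` is coprime to every power of `g`, Bézout recovers each `u` in V(g) from `c • u`. -/
theorem isFCyclic_of_not_dvd {M : Matrix (Fin n) (Fin n) F} {g c : F[X]} (hg : g.Monic)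
    (hirr : Irreducible g) (hgM : g ∣ M.charpoly) (hgc : ¬ g ∣ c) (v : RowModule M)
    (hc : ∀ u : RowModule M, c • u ∈ Submodule.span F[X] {v}) : IsFCyclic M := by
  refine ⟨g, hg, hirr, hgM, ?_⟩
  have hle : primaryPart M g ≤ Submodule.span F[X] {v} := by
    intro u hu
    obtain ⟨j, hj⟩ := (Ideal.primaryComponent_mem _ _ _).1 hu
    have hj' : g ^ j • u = 0 := by
      rw [Submodule.mem_torsionBySet_iff] at hj
      exact hj ⟨g ^ j, Ideal.pow_mem_pow (Ideal.mem_span_singleton_self g) j⟩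
    obtain ⟨r, s, hrs⟩ := ((hirr.coprime_iff_not_dvd.2 hgc).pow_left : IsCoprime (g ^ j) c)
    have : u = s • (c • u) := by
      calc u = (r * g ^ j + s * c) • u := by rw [hrs, one_smul]
        _ = s • (c • u) := by rw [add_smul, mul_smul, mul_smul, hj', smul_zero, zero_add]
    rw [this]
    exact Submodule.smul_mem _ _ (hc u)
  -- A submodule of a cyclic module over a PID is cyclic: pull it back to an ideal of `F[X]` and
  -- take a generator.
  obtain ⟨p, hp⟩ := (IsPrincipalIdealRing.principal
    ((primaryPart M g).comap (LinearMap.toSpanSingleton F[X] (RowModule M) v))).principal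
  refine ⟨p • v, le_antisymm (fun u hu => ?_) ?_⟩
  · obtain ⟨s, rfl⟩ := Submodule.mem_span_singleton.1 (hle hu)
    have : s ∈ Submodule.span F[X] {p} := hp ▸ (show s • v ∈ primaryPart M g from hu)
    obtain ⟨t, rfl⟩ := Submodule.mem_span_singleton.1 this
    rw [smul_assoc]
    exact Submodule.smul_mem _ _ (Submodule.mem_span_singleton_self _)
  · rw [Submodule.span_singleton_le_iff_mem]
    have : p ∈ (primaryPart M g).comap (LinearMap.toSpanSingleton F[X] (RowModule M) v) :=
      hp ▸ Submodule.mem_span_singleton_self p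
    exact this

theorem dvd_charpoly_complementEnd_of_not_isFCyclic {M : Matrix (Fin n) (Fin n) F}
    (hM : ¬ IsFCyclic M) {v : Fin n → F} {k : ℕ} (h : IsKrylovDegree M.vecMulLinear v k)
    {U W : Submodule F (Fin n → F)}
    (hW : W = Submodule.span F (Set.range fun i : Fin k => (M.vecMulLinear ^ (i : ℕ)) v))
    (hU : IsCompl U W)
    {a : Fin k → F}
    (ha : ∑ i, a i • (M.vecMulLinear ^ (i : ℕ)) v = (M.vecMulLinear ^ k) v)
    {g : F[X]} (hg : g.Monic) (hirr : Irreducible g) (hga : g ∣ monicOfCoeffs a) :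
    g ∣ (complementEnd hU (M.vecMulLinear.comp U.subtype)).charpoly := by
  subst hW
  by_contra hgc
  refine hM (isFCyclic_of_not_dvd hg hirr (hga.trans ?_) hgc (Module.AEval'.of _ v) fun u => ?_)
  · refine h.dvd_of_aeval_apply_eq_zero (monicOfCoeffs_monic a) (natDegree_monicOfCoeffs a)
      (aeval_monicOfCoeffs_apply ha) ?_
    rw [aeval_vecMulLinear_apply, Matrix.aeval_self_charpoly, Matrix.vecMul_zero]
  · obtain ⟨u, rfl⟩ := (Module.AEval'.of M.vecMulLinear).surjective u
    have hmem := aeval_charpoly_complementEnd_apply_mem hU M.vecMulLinear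
      (fun w hw => h.map_mem_span hw) u
    have hle : Submodule.span F (Set.range fun i : Fin k => (M.vecMulLinear ^ (i : ℕ)) v) ≤
        ((Submodule.span F[X] {Module.AEval'.of M.vecMulLinear v}).restrictScalars F).comap
          (Module.AEval'.of M.vecMulLinear).toLinearMap := by
      rw [Submodule.span_le]
      rintro _ ⟨i, rfl⟩
      change Module.AEval'.of M.vecMulLinear ((M.vecMulLinear ^ (i : ℕ)) v) ∈
        Submodule.span F[X] {Module.AEval'.of M.vecMulLinear v}
      refine Submodule.mem_span_singleton.2 ⟨X ^ (i : ℕ), ?_⟩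
      exact Module.AEval'.X_pow_smul_of _ _ _
    exact hle hmem

end FCyclic

/-! ### Counting polynomials whose irreducible factors are prescribed. -/

open UniqueFactorizationMonoid in
/-- The multiset of monic irreducible factors of `p`, each one repeated as often as its degree. -/
noncomputable def weightedFactors {F : Type*} [Field F] [DecidableEq F] (p : F[X]) : Multiset F[X] :=
  (normalizedFactors p).bind fun g => Multiset.replicate g.natDegree g

open UniqueFactorizationMonoid in
theorem monic_of_mem_normalizedFactors {F : Type*} [Field F] [DecidableEq F] {p g : F[X]}
    (hg : g ∈ normalizedFactors p) : g.Monic := by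
  rw [← normalize_normalized_factor g hg]
  exact monic_normalize (irreducible_of_normalized_factor g hg).ne_zero

open UniqueFactorizationMonoid in
theorem prod_normalizedFactors_of_monic {F : Type*} [Field F] [DecidableEq F] {p : F[X]} (hp : p.Monic) :
    (normalizedFactors p).prod = p := by
  rw [prod_normalizedFactors_eq hp.ne_zero, hp.normalize_eq_self]

open UniqueFactorizationMonoid in
theorem sum_natDegree_normalizedFactors {F : Type*} [Field F] [DecidableEq F] {p : F[X]} (hp : p.Monic) :
    ((normalizedFactors p).map natDegree).sum = p.natDegree := by
  conv_rhs => rw [← prod_normalizedFactors_of_monic hp]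
  rw [natDegree_multiset_prod]
  exact zero_notMem_normalizedFactors p

open UniqueFactorizationMonoid in
theorem card_weightedFactors {F : Type*} [Field F] [DecidableEq F] {p : F[X]} (hp : p.Monic) :
    (weightedFactors p).card = p.natDegree := by
  simp [weightedFactors, Multiset.card_bind, ← sum_natDegree_normalizedFactors hp]

open UniqueFactorizationMonoid in
theorem mem_normalizedFactors_of_mem_weightedFactors {F : Type*} [Field F] [DecidableEq F] {p g : F[X]}
    (hg : g ∈ weightedFactors p) : g ∈ normalizedFactors p := by
  obtain ⟨h, hh, hgh⟩ := Multiset.mem_bind.1 hg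
  rwa [Multiset.eq_of_mem_replicate hgh]

open UniqueFactorizationMonoid in
theorem weightedFactors_injOn {F : Type*} [Field F] [DecidableEq F] :
    Set.InjOn (weightedFactors : F[X] → Multiset F[X]) {p | p.Monic} := by
  have hcount : ∀ (p g : F[X]), (weightedFactors p).count g =
      (normalizedFactors p).count g * g.natDegree := by
    intro p g
    rw [weightedFactors, Multiset.count_bind]
    induction normalizedFactors p using Multiset.induction_on with
    | empty => simp
    | cons h s ih =>
      rw [Multiset.map_cons, Multiset.sum_cons, ih, Multiset.count_cons, Multiset.count_replicate]
      split_ifs with h1 h2 h2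
      · subst h1; ring
      · exact absurd h1.symm h2
      · exact absurd h2.symm h1
      · ring
  intro p hp r hr hpr
  rw [← prod_normalizedFactors_of_monic hp, ← prod_normalizedFactors_of_monic hr]
  congr 1
  ext g
  by_cases hg : Irreducible g
  · have := hcount p g
    rw [hpr, hcount r g] at this
    exact (Nat.eq_of_mul_eq_mul_right hg.natDegree_pos this).symm
  · rw [Multiset.count_eq_zero_of_notMem, Multiset.count_eq_zero_of_notMem]
    · exact fun h => hg (irreducible_of_normalized_factor g h)
    · exact fun h => hg (irreducible_of_normalized_factor g h)

-- Repeating factors by degree encodes each polynomial as a multiset of size exactly `k` on at most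
-- `c.natDegree` symbols.
open UniqueFactorizationMonoid in
theorem card_le_multichoose_of_factors_dvd {F : Type*} [Field F] {c : F[X]} (hc : c.Monic) {k : ℕ}
    (S : Finset F[X]) (hS : ∀ p ∈ S, p.Monic ∧ p.natDegree = k ∧
      ∀ g : F[X], g.Monic → Irreducible g → g ∣ p → g ∣ c) :
    S.card ≤ Nat.multichoose c.natDegree k := by
  classical
  set A := (normalizedFactors c).toFinset with hA
  have hAcard : A.card ≤ c.natDegree := by
    refine (Multiset.toFinset_card_le _).trans ?_
    rw [← sum_natDegree_normalizedFactors hc]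
    refine le_trans (by simp) (Multiset.card_nsmul_le_sum (s := (normalizedFactors c).map natDegree)
      (a := 1) fun x hx => ?_)
    obtain ⟨g, hg, rfl⟩ := Multiset.mem_map.1 hx
    exact (irreducible_of_normalized_factor g hg).natDegree_pos
  have hmem : ∀ p ∈ S, ∀ g ∈ weightedFactors p, g ∈ A := by
    intro p hp g hg
    have hg' := mem_normalizedFactors_of_mem_weightedFactors hg
    have hirr := irreducible_of_normalized_factor g hg'
    have hgm := monic_of_mem_normalizedFactors hg'
    rw [hA, Multiset.mem_toFinset, Polynomial.mem_normalizedFactors_iff hc.ne_zero]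
    exact ⟨hirr, hgm, (hS p hp).2.2 g hgm hirr (dvd_of_mem_normalizedFactors hg')⟩
  let φ : S → Sym A k := fun p => ⟨(weightedFactors (p : F[X])).attach.map
    (fun g => ⟨g.1, hmem p p.2 g.1 g.2⟩), by
      rw [Multiset.card_map, Multiset.card_attach, card_weightedFactors (hS p p.2).1,
        (hS p p.2).2.1]⟩
  have hφ : Function.Injective φ := by
    intro p r h
    have h1 := congrArg (fun m : Sym A k => (m : Multiset A).map Subtype.val) h
    have key : ∀ p : S, ((φ p : Sym A k) : Multiset A).map Subtype.val =
        weightedFactors (p : F[X]) := by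
      intro p
      change ((weightedFactors (p : F[X])).attach.map _).map _ = _
      rw [Multiset.map_map]
      exact Multiset.attach_map_val _
    simp only [key] at h1
    exact Subtype.ext (weightedFactors_injOn (hS p p.2).1 (hS r r.2).1 h1)
  calc S.card = Fintype.card S := (Fintype.card_coe S).symm
    _ ≤ Fintype.card (Sym A k) := Fintype.card_le_of_injective φ hφ
    _ = Nat.multichoose A.card k := by rw [Sym.card_sym_eq_multichoose, Fintype.card_coe]
    _ ≤ Nat.multichoose c.natDegree k := by
      rw [Nat.multichoose_eq, Nat.multichoose_eq]
      exact Nat.choose_le_choose _ (by omega)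

/-! ### Counting the matrices that are not `f`-cyclic. -/

section Counting

variable {F : Type*} [Field F] [Finite F] {n : ℕ}

/-- The number of non-`f`-cyclic matrices with a prescribed Krylov basis. -/
theorem card_le_of_krylov_basis {v : Fin n → F} {k : ℕ} (b : Fin k → Fin n → F)
    (S : Finset (Matrix (Fin n) (Fin n) F))
    (hS : ∀ M ∈ S, ¬ IsFCyclic M ∧ IsKrylovDegree M.vecMulLinear v k ∧
      (fun i : Fin k => (M.vecMulLinear ^ (i : ℕ)) v) = b) :
    S.card ≤ min (Nat.card F ^ k) (Nat.multichoose (n - k) k) * Nat.card F ^ (n * (n - k)) := by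
  classical
  rcases S.eq_empty_or_nonempty with rfl | ⟨M₀, hM₀⟩
  · simp
  have hb : LinearIndependent F b := (hS M₀ hM₀).2.2 ▸ (hS M₀ hM₀).2.1.1
  set W := Submodule.span F (Set.range b) with hWdef
  obtain ⟨U, hWU⟩ := Submodule.exists_isCompl W
  have hU : IsCompl U W := hWU.symm
  have hWM : ∀ M ∈ S,
      W = Submodule.span F (Set.range fun i : Fin k => (M.vecMulLinear ^ (i : ℕ)) v) :=
    fun M hM => by rw [(hS M hM).2.2]
  have hrank : Module.finrank F U = n - k := by
    have h1 := Submodule.finrank_add_eq_of_isCompl hU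
    have h2 : Module.finrank F W = k := by simpa using finrank_span_eq_card hb
    rw [Module.finrank_fin_fun] at h1
    omega
  have hcoord : ∀ M ∈ S, ∃ a : Fin k → F,
      ∑ i, a i • (M.vecMulLinear ^ (i : ℕ)) v = (M.vecMulLinear ^ k) v := fun M hM =>
    (Submodule.mem_span_range_iff_exists_fun F).1 (hS M hM).2.1.2
  choose! a ha using hcoord
  let ψ : Matrix (Fin n) (Fin n) F → (U →ₗ[F] (Fin n → F)) :=
    fun M => M.vecMulLinear.comp U.subtype
  have hstep : ∀ M ∈ S, ∀ i : Fin k, M.vecMulLinear (b i) = (M.vecMulLinear ^ ((i : ℕ) + 1)) v := by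
    intro M hM i
    rw [← (hS M hM).2.2, pow_succ', Module.End.mul_apply]
  have hinj : ∀ M ∈ S, ∀ N ∈ S, ψ M = ψ N → a M = a N → M = N := by
    intro M hM N hN hψ haMN
    have hbasis : ∀ i : Fin k, M.vecMulLinear (b i) = N.vecMulLinear (b i) := by
      intro i
      rw [hstep M hM, hstep N hN]
      have hpow : ∀ i : Fin k, (M.vecMulLinear ^ (i : ℕ)) v = (N.vecMulLinear ^ (i : ℕ)) v :=
        fun i => congrFun ((hS M hM).2.2.trans (hS N hN).2.2.symm) i
      rcases (Nat.succ_le_of_lt i.2).lt_or_eq with hi | hi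
      · exact hpow ⟨i + 1, hi⟩
      · rw [← Nat.succ_eq_add_one, hi, ← ha M hM, ← ha N hN, haMN]
        simp only [hpow]
    have hW : W ≤ LinearMap.eqLocus M.vecMulLinear N.vecMulLinear := by
      rw [hWdef, Submodule.span_le]
      rintro _ ⟨i, rfl⟩
      exact hbasis i
    have hUle : U ≤ LinearMap.eqLocus M.vecMulLinear N.vecMulLinear :=
      fun u hu => LinearMap.congr_fun hψ ⟨u, hu⟩
    have htop : ∀ x, M.vecMulLinear x = N.vecMulLinear x := fun x =>
      (hU.sup_eq_top ▸ sup_le hUle hW : (⊤ : Submodule F (Fin n → F)) ≤ _) (Submodule.mem_top (x := x))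
    refine Matrix.ext_of_single_vecMul fun i => ?_
    exact htop _
  have : Finite (U →ₗ[F] (Fin n → F)) := Module.finite_of_finite F
  have : Fintype (U →ₗ[F] (Fin n → F)) := Fintype.ofFinite _
  have : Fintype F := Fintype.ofFinite F
  have himage : (S.image ψ).card ≤ Nat.card F ^ (n * (n - k)) := by
    refine (Finset.card_le_univ _).trans ?_
    rw [← Nat.card_eq_fintype_card, Module.natCard_eq_pow_finrank (K := F),
      Module.finrank_linearMap, hrank, Module.finrank_fin_fun, mul_comm]
  -- Group by the action `R` on `U`. Within a fibre the induced characteristic polynomial is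
  -- constant and `a M` determines `M`.
  refine (Finset.card_le_mul_card_image S _ fun R hR => ?_).trans (Nat.mul_le_mul_left _ himage)
  have hfib : ∀ M ∈ S.filter (fun M => ψ M = R), M ∈ S ∧ ψ M = R := fun M hM =>
    Finset.mem_filter.1 hM
  have hainj : Set.InjOn a (S.filter fun M => ψ M = R : Finset _) := fun M hM N hN h =>
    hinj M (hfib M hM).1 N (hfib N hN).1 ((hfib M hM).2.trans (hfib N hN).2.symm) h
  refine le_min ?_ ?_
  · rw [← Finset.card_image_of_injOn hainj]
    refine (Finset.card_le_univ _).trans ?_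
    simp [Nat.card_eq_fintype_card]
  · rw [← Finset.card_image_of_injOn (f := fun M => monicOfCoeffs (a M))
      (fun M hM N hN h => hainj hM hN (monicOfCoeffs_injective h))]
    have hdeg : (complementEnd hU R).charpoly.natDegree = n - k := by
      rw [LinearMap.charpoly_natDegree, hrank]
    rw [← hdeg]
    refine card_le_multichoose_of_factors_dvd (LinearMap.charpoly_monic _) _ fun p hp => ?_
    obtain ⟨M, hM, rfl⟩ := Finset.mem_image.1 hp
    obtain ⟨hMS, hMR⟩ := hfib M hM
    refine ⟨monicOfCoeffs_monic _, natDegree_monicOfCoeffs _, fun g hg hirr hga => ?_⟩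
    rw [← hMR]
    exact dvd_charpoly_complementEnd_of_not_isFCyclic (hS M hMS).1 (hS M hMS).2.1 (hWM M hMS) hU
      (ha M hMS) hg hirr hga

/-- The first Krylov vector is the fixed `v`, so only `k` of the `k + 1` are free. -/
theorem card_le_of_isKrylovDegree {v : Fin n → F} {k : ℕ}
    (S : Finset (Matrix (Fin n) (Fin n) F))
    (hS : ∀ M ∈ S, ¬ IsFCyclic M ∧ IsKrylovDegree M.vecMulLinear v (k + 1)) :
    S.card ≤ min (Nat.card F ^ (k + 1)) (Nat.multichoose (n - (k + 1)) (k + 1)) *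
      Nat.card F ^ (n * (n - (k + 1))) * Nat.card F ^ (n * k) := by
  classical
  have : Fintype F := Fintype.ofFinite F
  let φ : Matrix (Fin n) (Fin n) F → (Fin k → Fin n → F) :=
    fun M i => (M.vecMulLinear ^ ((i : ℕ) + 1)) v
  have himage : (S.image φ).card ≤ Nat.card F ^ (n * k) := by
    refine (Finset.card_le_univ _).trans ?_
    simp [Nat.card_eq_fintype_card, pow_mul]
  refine (Finset.card_le_mul_card_image S _ fun d hd => ?_).trans (Nat.mul_le_mul_left _ himage)
  refine card_le_of_krylov_basis (v := v) (Fin.cons v d) _ fun M hM => ?_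
  obtain ⟨hMS, hMd⟩ := Finset.mem_filter.1 hM
  refine ⟨(hS M hMS).1, (hS M hMS).2, ?_⟩
  funext i
  refine Fin.cases ?_ (fun j => ?_) i
  · simp
  · rw [Fin.cons_succ, ← hMd, Fin.val_succ]

theorem card_not_isFCyclic_le (F : Type*) [Field F] [Finite F] (m : ℕ) :
    Nat.card {M : Matrix (Fin (m + 1)) (Fin (m + 1)) F // ¬ IsFCyclic M} ≤
      ∑ i ∈ Finset.range m, min (Nat.card F ^ (m - i)) (m.choose i) *
        Nat.card F ^ ((m + 1) * m) := by
  classical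
  have : Fintype F := Fintype.ofFinite F
  rw [Nat.card_eq_fintype_card, Fintype.card_subtype]
  set v : Fin (m + 1) → F := Pi.single 0 1 with hv
  have hv0 : v ≠ 0 := by simp [hv]
  let A : ℕ → Finset (Matrix (Fin (m + 1)) (Fin (m + 1)) F) := fun k =>
    Finset.univ.filter fun M => ¬ IsFCyclic M ∧ IsKrylovDegree M.vecMulLinear v (k + 1)
  have hcover : (Finset.univ.filter fun M : Matrix (Fin (m + 1)) (Fin (m + 1)) F =>
      ¬ IsFCyclic M) ⊆ (Finset.range (m + 1)).biUnion A := by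
    intro M hM
    obtain ⟨k, h1, h2, h3⟩ := exists_isKrylovDegree M.vecMulLinear hv0
    rw [Module.finrank_fin_fun] at h2
    obtain ⟨k, rfl⟩ := Nat.exists_eq_add_of_le' h1
    exact Finset.mem_biUnion.2 ⟨k, Finset.mem_range.2 (by omega),
      Finset.mem_filter.2 ⟨Finset.mem_univ _, (Finset.mem_filter.1 hM).2, h3⟩⟩
  refine (Finset.card_le_card hcover).trans (Finset.card_biUnion_le.trans ?_)
  have hA : ∀ k ∈ Finset.range (m + 1), (A k).card ≤
      min (Nat.card F ^ (k + 1)) (Nat.multichoose (m - k) (k + 1)) *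
        Nat.card F ^ ((m + 1) * m) := by
    intro k hk
    refine (card_le_of_isKrylovDegree (A k) fun M hM => (Finset.mem_filter.1 hM).2).trans ?_
    have hk' := Finset.mem_range.1 hk
    rw [mul_assoc, ← pow_add, ← mul_add, Nat.add_sub_add_right, Nat.sub_add_cancel (by omega)]
  refine (Finset.sum_le_sum hA).trans ?_
  rw [← Finset.sum_range_reflect, Finset.sum_range_succ', Nat.add_sub_cancel]
  -- Here `v` generates the whole space and the quotient is zero: such a matrix is always
  -- `f`-cyclic.
  have h0 : min (Nat.card F ^ (m - 0 + 1)) (Nat.multichoose (m - (m - 0)) (m - 0 + 1)) = 0 := by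
    simp
  rw [h0, zero_mul, add_zero]
  refine Finset.sum_le_sum fun i hi => ?_
  have hi' := Finset.mem_range.1 hi
  have e1 : m - (i + 1) + 1 = m - i := by omega
  have e2 : m - (m - (i + 1)) = i + 1 := by omega
  rw [e1, e2, Nat.multichoose_eq, show i + 1 + (m - i) - 1 = m by omega,
    Nat.choose_symm (by omega)]

end Counting

/-! ### Numerical estimate and conclusion. -/

theorem sum_min_choose_le (m : ℕ) (hm : 1 ≤ m) :
    ∑ i ∈ Finset.range m, min ((1 / 2 : ℝ) ^ (i + 1)) (m.choose i * (1 / 2) ^ (m + 1)) ≤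
      (0.983 : ℝ) ^ (m + 1) := by
  -- Cut-off: for `i ≤ a` the weight `8 ^ (a - i) ≥ 1` turns the binomial sum into (9/8)^m; for `i >
  -- a` the geometric bound is used.
  set a := (m + 1) / 8 with ha
  have hterm : ∀ i ∈ Finset.range m,
      min ((1 / 2 : ℝ) ^ (i + 1)) (m.choose i * (1 / 2) ^ (m + 1)) ≤
        (8 ^ a * (1 / 2) ^ (m + 1)) * ((1 / 8) ^ i * 1 ^ (m - i) * m.choose i) +
          if a < i then (1 / 2 : ℝ) ^ (i + 1) else 0 := by
    intro i _
    split_ifs with h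
    · exact (min_le_left _ _).trans (le_add_of_nonneg_left (by positivity))
    · refine (min_le_right _ _).trans ?_
      rw [add_zero, one_pow, mul_one]
      have h8 : (1 : ℝ) ≤ 8 ^ a * (1 / 8) ^ i := by
        rw [← Nat.sub_add_cancel (not_lt.1 h), pow_add, mul_assoc, ← mul_pow]
        norm_num
        exact one_le_pow₀ (by norm_num)
      calc (m.choose i : ℝ) * (1 / 2) ^ (m + 1)
          ≤ (m.choose i * (1 / 2) ^ (m + 1)) * (8 ^ a * (1 / 8) ^ i) :=
            le_mul_of_one_le_right (by positivity) h8
        _ = _ := by ring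
  -- The extra summand is the unused rest of the geometric series, which makes the induction
  -- telescope.
  have htail : ∀ j : ℕ, ∑ i ∈ Finset.range j, (if a < i then (1 / 2 : ℝ) ^ (i + 1) else 0) +
      (1 / 2) ^ (max j (a + 1)) ≤ (1 / 2) ^ (a + 1) := by
    intro j
    induction j with
    | zero => simp
    | succ j ih =>
      rw [Finset.sum_range_succ]
      split_ifs with h
      · rw [max_eq_left (by omega)] at ih ⊢
        have : (1 / 2 : ℝ) ^ (j + 1) + (1 / 2) ^ (j + 1) = (1 / 2) ^ j := by ring
        linarith
      · rw [max_eq_right (by omega)] at ih ⊢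
        linarith
  have hbin : ∑ i ∈ Finset.range m, ((1 / 8 : ℝ) ^ i * 1 ^ (m - i) * m.choose i) ≤ (9 / 8) ^ m := by
    have := add_pow (1 / 8 : ℝ) 1 m
    rw [Finset.sum_range_succ] at this
    norm_num at this ⊢
    rw [this]
    exact le_add_of_nonneg_right (by positivity)
  have hpow : (0 : ℝ) ≤ (1 / 2) ^ (max m (a + 1)) := by positivity
  refine (Finset.sum_le_sum hterm).trans ?_
  rw [Finset.sum_add_distrib, ← Finset.mul_sum]
  have h1 := mul_le_mul_of_nonneg_left hbin (show (0 : ℝ) ≤ 8 ^ a * (1 / 2) ^ (m + 1) by positivity)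
  have h2 := htail m
  suffices h : 8 ^ a * (1 / 2) ^ (m + 1) * (9 / 8 : ℝ) ^ m + (1 / 2) ^ (a + 1) ≤
      0.983 ^ (m + 1) by linarith
  obtain ⟨b, hb, hmb⟩ : ∃ b, b < 8 ∧ m + 1 = 8 * a + b := ⟨(m + 1) % 8, Nat.mod_lt _ (by norm_num), by omega⟩
  have e1 : 8 ^ a * (1 / 2) ^ (m + 1) * (9 / 8 : ℝ) ^ m =
      (8 / 9) * ((8 * (9 / 16) ^ 8) ^ a * (9 / 16) ^ b) := by
    have : (9 / 8 : ℝ) ^ m = (8 / 9) * (9 / 8) ^ (m + 1) := by rw [pow_succ]; ring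
    calc 8 ^ a * (1 / 2) ^ (m + 1) * (9 / 8 : ℝ) ^ m
        = (8 / 9) * (8 ^ a * (1 / 2 * (9 / 8)) ^ (m + 1)) := by rw [this, mul_pow (1 / 2 : ℝ)]; ring
      _ = (8 / 9) * (8 ^ a * (9 / 16) ^ (8 * a + b)) := by rw [hmb]; norm_num
      _ = _ := by rw [pow_add, pow_mul, mul_pow]; ring
  have hb1 : (0.886 : ℝ) ≤ 0.983 ^ b := by
    calc (0.886 : ℝ) ≤ 0.983 ^ 7 := by norm_num
      _ ≤ 0.983 ^ b := pow_le_pow_of_le_one (by norm_num) (by norm_num) (by omega)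
  -- Uses 0.983^8 ≥ 1/2 for each block of eight.
  have e2 : (0.886 : ℝ) * (1 / 2) ^ a ≤ 0.983 ^ (m + 1) := by
    rw [hmb, pow_add, pow_mul, mul_comm]
    exact mul_le_mul (pow_le_pow_left₀ (by norm_num) (by norm_num) a) hb1 (by norm_num)
      (by positivity)
  refine le_trans ?_ e2
  rw [e1, pow_succ (1 / 2 : ℝ) a]
  rcases Nat.eq_zero_or_pos a with h0 | h0
  -- With `a = 0`, `b = m + 1 ≥ 2`.
  · have hb2 : (9 / 16 : ℝ) ^ b ≤ (9 / 16) ^ 2 :=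
      pow_le_pow_of_le_one (by norm_num) (by norm_num) (by omega)
    rw [h0]
    norm_num at hb2 ⊢
    linarith
  · have hb2 : (9 / 16 : ℝ) ^ b ≤ 1 := pow_le_one₀ (by norm_num) (by norm_num)
    obtain ⟨d, hd⟩ : ∃ d, a = d + 1 := ⟨a - 1, by omega⟩
    have h3 : (8 * (9 / 16) ^ 8 : ℝ) ^ a ≤ 0.09 * (1 / 2) ^ d := by
      rw [hd, pow_succ, mul_comm]
      exact mul_le_mul (by norm_num) (pow_le_pow_left₀ (by norm_num) (by norm_num) d)
        (by positivity) (by norm_num)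
    have h4 : (8 * (9 / 16) ^ 8 : ℝ) ^ a * (9 / 16) ^ b ≤ (8 * (9 / 16) ^ 8 : ℝ) ^ a :=
      mul_le_of_le_one_right (by positivity) hb2
    have h5 : (1 / 2 : ℝ) ^ a = (1 / 2) ^ d * (1 / 2) := by rw [hd, pow_succ]
    have h6 : (0 : ℝ) < (1 / 2) ^ d := by positivity
    rw [h5]
    linarith

theorem one_sub_pow_le_fCyclicProportion (F : Type*) [Field F] [Finite F] {n : ℕ} (hn : 1 ≤ n) :
    1 - (0.983 : ℝ) ^ n ≤ fCyclicProportion F n := by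
  classical
  have : Fintype F := Fintype.ofFinite F
  obtain ⟨m, rfl⟩ := Nat.exists_eq_add_of_le' hn
  set q : ℝ := (Nat.card F : ℝ) with hq
  have hq2 : 2 ≤ q := by
    rw [hq]
    exact_mod_cast Finite.one_lt_card (α := F)
  have hq0 : 0 < q := by linarith
  have hsplit : Nat.card {M : Matrix (Fin (m + 1)) (Fin (m + 1)) F // IsFCyclic M} +
      Nat.card {M : Matrix (Fin (m + 1)) (Fin (m + 1)) F // ¬ IsFCyclic M} =
      Nat.card (Matrix (Fin (m + 1)) (Fin (m + 1)) F) := by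
    rw [← Nat.card_sum]
    exact Nat.card_congr (Equiv.sumCompl _)
  have htotal : (Nat.card (Matrix (Fin (m + 1)) (Fin (m + 1)) F) : ℝ) =
      q ^ (m + 1) * q ^ ((m + 1) * m) := by
    rw [show Nat.card (Matrix (Fin (m + 1)) (Fin (m + 1)) F) =
      Nat.card (Fin (m + 1) → Fin (m + 1) → F) from rfl]
    simp only [Nat.card_fun, Nat.card_fin, Nat.cast_pow, ← hq, ← pow_mul, ← pow_add]
    ring_nf
  have hpos : 0 < q ^ (m + 1) * q ^ ((m + 1) * m) := by positivity
  have hunc : (Nat.card {M : Matrix (Fin (m + 1)) (Fin (m + 1)) F // ¬ IsFCyclic M} : ℝ) ≤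
      0.983 ^ (m + 1) * (q ^ (m + 1) * q ^ ((m + 1) * m)) := by
    rcases Nat.eq_zero_or_pos m with rfl | hm
    · have := card_not_isFCyclic_le F 0
      rw [Finset.sum_range_zero, Nat.le_zero] at this
      rw [this, Nat.cast_zero]
      positivity
    have h1 : (Nat.card {M : Matrix (Fin (m + 1)) (Fin (m + 1)) F // ¬ IsFCyclic M} : ℝ) ≤
        ∑ i ∈ Finset.range m, min (q ^ (m - i)) (m.choose i : ℝ) * q ^ ((m + 1) * m) := by
      rw [hq]
      exact_mod_cast card_not_isFCyclic_le F m
    -- After division by `q ^ (m + 1)` both bounds decrease in `q`, so `q = 2` is the worst case.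
    have hterm : ∀ i ∈ Finset.range m, min (q ^ (m - i)) (m.choose i : ℝ) ≤
        min ((1 / 2 : ℝ) ^ (i + 1)) (m.choose i * (1 / 2) ^ (m + 1)) * q ^ (m + 1) := by
      intro i hi
      have hi' := Finset.mem_range.1 hi
      have hpow : ∀ j, 1 ≤ (1 / 2 : ℝ) ^ j * q ^ j := fun j => by
        rw [← mul_pow]
        exact one_le_pow₀ (by linarith)
      rw [min_mul_of_nonneg _ _ (by positivity)]
      refine min_le_min ?_ ?_
      · calc q ^ (m - i) ≤ ((1 / 2 : ℝ) ^ (i + 1) * q ^ (i + 1)) * q ^ (m - i) :=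
              le_mul_of_one_le_left (by positivity) (hpow _)
          _ = (1 / 2 : ℝ) ^ (i + 1) * q ^ (m + 1) := by
              rw [mul_assoc, ← pow_add, show i + 1 + (m - i) = m + 1 by omega]
      · rw [mul_assoc]
        exact le_mul_of_one_le_right (by positivity) (hpow _)
    calc _ ≤ _ := h1
      _ = (∑ i ∈ Finset.range m, min (q ^ (m - i)) (m.choose i : ℝ)) * q ^ ((m + 1) * m) := by
          rw [Finset.sum_mul]
      _ ≤ ((∑ i ∈ Finset.range m, min ((1 / 2 : ℝ) ^ (i + 1)) (m.choose i * (1 / 2) ^ (m + 1))) *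
            q ^ (m + 1)) * q ^ ((m + 1) * m) := by
          refine mul_le_mul_of_nonneg_right ?_ (by positivity)
          rw [Finset.sum_mul]
          exact Finset.sum_le_sum hterm
      _ ≤ (0.983 ^ (m + 1) * q ^ (m + 1)) * q ^ ((m + 1) * m) := by
          gcongr
          exact sum_min_choose_le m hm
      _ = _ := mul_assoc _ _ _
  have hsplit' : (Nat.card {M : Matrix (Fin (m + 1)) (Fin (m + 1)) F // IsFCyclic M} : ℝ) =
      q ^ (m + 1) * q ^ ((m + 1) * m) -
        Nat.card {M : Matrix (Fin (m + 1)) (Fin (m + 1)) F // ¬ IsFCyclic M} := by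
    rw [← htotal, ← hsplit, Nat.cast_add, add_sub_cancel_right]
  rw [fCyclicProportion, htotal, le_div_iff₀ hpos, hsplit']
  linarith

theorem theorem1 :
    (∃ c : ℝ, 0 < c ∧ c < 1 ∧
      ∀ (F : Type*) [Field F] [Finite F] (n : ℕ), 1 ≤ n → 1 - c ^ n ≤ fCyclicProportion F n) ∧
    (∀ (F : Type*) [Field F] [Finite F] (n : ℕ), 1 ≤ n →
      1 - (0.983 : ℝ) ^ n ≤ fCyclicProportion F n) :=
  ⟨⟨0.983, by norm_num, by norm_num, fun F _ _ _ hn => one_sub_pow_le_fCyclicProportion F hn⟩,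
    fun F _ _ _ hn => one_sub_pow_le_fCyclicProportion F hn⟩
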